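/- Let $\mathcal G$ be a second countable, locally compact, Hausdorff, étale, ample groupoid (its topology has a basis of compact open bisections) whose unit space $\mathcal G^{(0)}$ is compact, and suppose that $\mathcal G$ is minimal, i.e. $\mathcal G^{(0)}$ has no closed invariant subsets other than $\emptyset$ and $\mathcal G^{(0)}$. Write $s,r$ for the source and range maps and $Su=\{\gamma\in S: s(\gamma)=u\}$ for $S\subset\mathcal G$ and $u\in\mathcal G^{(0)}$. A compact open multisection is a finite family $\{C_{i,j}: i,j\in F\}$ of compact open bisections with $C_{i,j}C_{j,k}=C_{i,k}$ for all $i,j,k\in F$ such that the $C_{i,i}$ $(i\in F)$ are pairwise disjoint subsets of $\mathcal G^{(0)}$. For $K\subset\mathcal G$ and $\epsilon>0$, a finite non-empty set $F\subset\mathcal G$ is called $(K,\epsilon)$-Følner if $|\partial_KF|\le\epsilon|F|$, where $\partial_KF=(KF\setminus F)\cup\{x\in F: yx\notin F\text{ for some composable }y\in K\}$. For $K$ compact, a compact open set $S\subset\mathcal G$ is a normal $(K,\epsilon)$-Følner set if there are compact open multisections $\{C^l_{i,j}: i,j\in F_l\}$, $1\le l\le m$, and indices $i_l\in F_l$ such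 that $S=\bigcup_{l=1}^m\bigsqcup_{i\in F_l}C^l_{i,i_l}$, $\mathcal G^{(0)}=\bigsqcup_{l=1}^mC^l_{i_l,i_l}$, and $Su$ is $(K,\epsilon)$-Følner for every $u\in\mathcal G^{(0)}$. A Følner sequence of $\mathcal G$ is a sequence $(S_n)_{n\in\mathbb N}$ of subsets of $\mathcal G$, each of which is a normal $(K_n,\epsilon_n)$-Følner set for some compact $K_n\subset\mathcal G$ and some $\epsilon_n>0$, such that for every compact $K\subset\mathcal G$ and every $u\in\mathcal G^{(0)}$ $$\frac{|KS_nu\setminus S_nu|}{|S_nu|}\longrightarrow 0\qquad(n\to\infty).$$ The topological full group $[[\mathcal G]]$ is the group of all homeomorphisms of $\mathcal G^{(0)}$ of the form $\pi_B=r\circ(s|_B)^{-1}$, where $B$ is a compact open bisection with $s(B)=r(B)=\mathcal G^{(0)}$. Suppose that $\mathcal G$ admits a Følner sequence. Then $[[\mathcal G]]$ is sofic: for every finite $F\subset[[\mathcal G]]$ and every $\epsilon>0$ there are a finite non-empty set $A$ and a map $\Theta$ from $[[\mathcal G]]$ to the set of all maps $A\to A$ such that, with $d_H(f,g)=|\{x\in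 A: f(x)\ne g(x)\}|/|A|$, 1. $d_H(\Theta(fg),\Theta(f)\Theta(g))\le\epsilon$ whenever $f,g,fg\in F$; 2. $d_H(\Theta(f),\mathrm{id}_A)>1-\epsilon$ whenever $f\in F$ is not the identity; 3. $\Theta(\mathrm{id}_{\mathcal G^{(0)}})=\mathrm{id}_A$. -/

import Mathlib

open CategoryTheory Topology

universe u v

namespace EtaleGroupoid

/-! ### Groupoids as spaces of arrows

An algebraic groupoid is a small category `X` all of whose arrows are invertible. Its space of units
is the type of objects `X`, and the groupoid itself, as a set with a partially defined product, is
the set `Arr X` of all arrows. The product `mul a b` is defined when the source of `a` is the range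
of `b`: first `b`, then `a`. -/

/-- The set of all arrows of a groupoid with unit space `X`. -/
abbrev Arr (X : Type u) [Groupoid.{v} X] : Type (max u v) := Quiver.Total X

section Algebra

variable {X : Type u} [Groupoid.{v} X]

/-- The source map. -/
def src (g : Arr X) : X := g.left

/-- The range map. -/
def rng (g : Arr X) : X := g.right

/-- The inclusion of the unit space into the groupoid. -/
def unit (x : X) : Arr X := ⟨x, x, 𝟙 x⟩

/-- The inversion. -/
def inv (g : Arr X) : Arr X := ⟨g.right, g.left, Groupoid.inv g.hom⟩

theorem inv_inv (g : Arr X) : inv (inv g) = g := by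
  obtain ⟨a, b, f⟩ := g
  simp [inv]

/-- The product `ab` of two composable elements. -/
def mul (a b : Arr X) (h : src a = rng b) : Arr X :=
  ⟨b.left, a.right, b.hom ≫ eqToHom h.symm ≫ a.hom⟩

/-- The product of two subsets: all products of composable pairs. -/
def setMul (A B : Set (Arr X)) : Set (Arr X) :=
  {g | ∃ a ∈ A, ∃ b ∈ B, ∃ h : src a = rng b, mul a b h = g}

/-- The set of units, as a subset of the groupoid. -/
def unitSet (X : Type u) [Groupoid.{v} X] : Set (Arr X) := Set.range unit

/-- The part `Su` of a set `S` in the source fibre over the unit `u`. -/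
def fiber (S : Set (Arr X)) (u : X) : Set (Arr X) := {g ∈ S | src g = u}

/-- A set `D` of units is invariant if `r(GD) = D`. -/
def IsInvariant (D : Set X) : Prop := rng '' {g : Arr X | src g ∈ D} = D

/-- The left outer `K`-boundary `KA \ A`. -/
def outerBoundary (K A : Set (Arr X)) : Set (Arr X) := setMul K A \ A

/-- The left inner `K`-boundary: all `x ∈ A` with `yx ∉ A` for some `y ∈ K`. -/
def innerBoundary (K A : Set (Arr X)) : Set (Arr X) :=
  {x ∈ A | ∃ y ∈ K, ∃ h : src y = rng x, mul y x h ∉ A}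

/-- The left `K`-boundary. -/
def boundary (K A : Set (Arr X)) : Set (Arr X) := outerBoundary K A ∪ innerBoundary K A

/-- A finite non-empty set `F` is `(K, ε)`-Følner if `|∂_K F| / |F| ≤ ε`. -/
def IsFolner (K : Set (Arr X)) (ε : ℝ) (F : Set (Arr X)) : Prop :=
  F.Finite ∧ F.Nonempty ∧ (boundary K F).Finite ∧
    ((boundary K F).ncard : ℝ) / (F.ncard : ℝ) ≤ ε

end Algebra

/-! ### Topological groupoids -/

/-- A topological groupoid. Since `unit` is a continuous section of the continuous map `src`, the
topology of the unit space `X` is the one induced from the space of arrows. -/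
class IsTopologicalGroupoid (X : Type u) [Groupoid.{v} X] [TopologicalSpace X]
    [TopologicalSpace (Arr X)] : Prop where
  continuous_src : Continuous (src : Arr X → X)
  continuous_rng : Continuous (rng : Arr X → X)
  continuous_unit : Continuous (unit : X → Arr X)
  continuous_inv : Continuous (inv : Arr X → Arr X)
  continuous_mul :
    Continuous fun p : {p : Arr X × Arr X // src p.1 = rng p.2} => mul p.1.1 p.1.2 p.2

/-- A topological groupoid is étale if its range map is a local homeomorphism. -/
class IsEtaleGroupoid (X : Type u) [Groupoid.{v} X] [TopologicalSpace X]
    [TopologicalSpace (Arr X)] : Prop extends IsTopologicalGroupoid X where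
  isLocalHomeomorph_rng : IsLocalHomeomorph (rng : Arr X → X)

section Topological

variable {X : Type u} [Groupoid.{v} X] [TopologicalSpace X] [TopologicalSpace (Arr X)]

/-- A bisection: a subset of an open set on which source and range map are homeomorphisms onto
open subsets of the unit space. -/
def IsBisection (B : Set (Arr X)) : Prop :=
  ∃ U : Set (Arr X), IsOpen U ∧ B ⊆ U ∧
    IsOpenEmbedding (U.domRestrict src) ∧ IsOpenEmbedding (U.domRestrict rng)

/-- A compact open bisection. -/
def IsCompactOpenBisection (B : Set (Arr X)) : Prop :=
  IsCompact B ∧ IsOpen B ∧ IsBisection B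

/-- A compact open multisection `{C i j : i, j ∈ ι}`. -/
structure IsCompactOpenMultisection {ι : Type*} (C : ι → ι → Set (Arr X)) : Prop where
  bisection : ∀ i j, IsCompactOpenBisection (C i j)
  setMul_eq : ∀ i j k, setMul (C i j) (C j k) = C i k
  subset_unitSet : ∀ i, C i i ⊆ unitSet X
  disjoint : Pairwise fun i j => Disjoint (C i i) (C j j)

/-- A normal `(K, ε)`-Følner set. The finite index sets are `Fin m` and `Fin (k l)`, and `i₀ l` is
the distinguished index of the `l`-th multisection. -/
def IsNormalFolner (K : Set (Arr X)) (ε : ℝ) (S : Set (Arr X)) : Prop :=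
  IsCompact S ∧ IsOpen S ∧
    ∃ (m : ℕ) (k : Fin m → ℕ) (C : ∀ l, Fin (k l) → Fin (k l) → Set (Arr X))
      (i₀ : ∀ l, Fin (k l)),
      (∀ l, IsCompactOpenMultisection (C l)) ∧
      S = ⋃ l, ⋃ i, C l i (i₀ l) ∧
      (∀ l, Pairwise fun i j => Disjoint (C l i (i₀ l)) (C l j (i₀ l))) ∧
      unitSet X = ⋃ l, C l (i₀ l) (i₀ l) ∧
      (Pairwise fun l l' => Disjoint (C l (i₀ l) (i₀ l)) (C l' (i₀ l') (i₀ l'))) ∧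
      ∀ u : X, IsFolner K ε (fiber S u)

/-- A Følner sequence: a sequence of normal Følner sets such that `|K Sₙu \ Sₙu| / |Sₙu|` tends to
`0` for every compact set `K` and every unit `u`. -/
def IsFolnerSequence (S : ℕ → Set (Arr X)) : Prop :=
  (∀ n, ∃ (K : Set (Arr X)) (ε : ℝ), IsCompact K ∧ 0 < ε ∧ IsNormalFolner K ε (S n)) ∧
    ∀ K : Set (Arr X), IsCompact K → ∀ u : X,
      Filter.Tendsto
        (fun n => ((setMul K (fiber (S n) u) \ fiber (S n) u).ncard : ℝ) /
          ((fiber (S n) u).ncard : ℝ))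
        Filter.atTop (𝓝 0)

end Topological

/-- An étale groupoid is ample if its topology has a basis of compact open bisections. -/
class IsAmpleGroupoid (X : Type u) [Groupoid.{v} X] [TopologicalSpace X]
    [TopologicalSpace (Arr X)] : Prop extends IsEtaleGroupoid X where
  isTopologicalBasis :
    TopologicalSpace.IsTopologicalBasis {B : Set (Arr X) | IsCompactOpenBisection B}

/-- A groupoid is minimal if its unit space has no closed invariant subsets other than the empty
set and the whole space. -/
def IsMinimalGroupoid (X : Type u) [Groupoid.{v} X] [TopologicalSpace X] : Prop :=
  ∀ D : Set X, IsClosed D → IsInvariant D → D = ∅ ∨ D = Set.univ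

/-! ### The topological full group -/

section FullGroup

variable {X : Type u} [Groupoid.{v} X] [TopologicalSpace X] [TopologicalSpace (Arr X)]

/-- `φ = π_B` for a compact open bisection `B` with `s(B) = r(B) = X`. Here `π_B` maps `s(b)` to
`r(b)` for `b ∈ B`. -/
def IsFullGroupElement (φ : X ≃ₜ X) : Prop :=
  ∃ B : Set (Arr X), IsCompactOpenBisection B ∧ src '' B = Set.univ ∧ rng '' B = Set.univ ∧
    ∀ b ∈ B, φ (src b) = rng b

theorem isLocalHomeomorph_src [IsEtaleGroupoid X] : IsLocalHomeomorph (src : Arr X → X) := by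
  let e : Arr X ≃ₜ Arr X :=
    { toFun := inv
      invFun := inv
      left_inv := inv_inv
      right_inv := inv_inv
      continuous_toFun := IsTopologicalGroupoid.continuous_inv
      continuous_invFun := IsTopologicalGroupoid.continuous_inv }
  exact (IsEtaleGroupoid.isLocalHomeomorph_rng (X := X)).comp e.isLocalHomeomorph

/-- The elements of the topological full group are given by continuous sections of the source
map. -/
theorem isFullGroupElement_iff [IsEtaleGroupoid X] [CompactSpace X] (φ : X ≃ₜ X) :
    IsFullGroupElement φ ↔
      ∃ σ : X → Arr X, Continuous σ ∧ (∀ x, src (σ x) = x) ∧ ∀ x, rng (σ x) = φ x := by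
  constructor
  · rintro ⟨B, ⟨-, hBo, U, -, hBU, hs, -⟩, hsB, -, hφ⟩
    have hs' : IsOpenEmbedding (B.domRestrict src) :=
      IsOpenEmbedding.of_continuous_injective_isOpenMap
        (isLocalHomeomorph_src.continuous.comp continuous_subtype_val)
        (fun x y h => Subtype.ext (Subtype.mk.inj
          (hs.injective (a₁ := ⟨x.1, hBU x.2⟩) (a₂ := ⟨y.1, hBU y.2⟩) h)))
        (isLocalHomeomorph_src.isOpenMap.comp hBo.isOpenMap_subtype_val)
    have hsurj : Function.Surjective (B.domRestrict (src : Arr X → X)) := by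
      intro x
      have hx : x ∈ src '' B := hsB ▸ Set.mem_univ x
      obtain ⟨b, hb, rfl⟩ := hx
      exact ⟨⟨b, hb⟩, rfl⟩
    let e : B ≃ₜ X := hs'.isEmbedding.toHomeomorphOfSurjective hsurj
    have he : ∀ x, src (e.symm x).1 = x := fun x => e.apply_symm_apply x
    refine ⟨fun x => (e.symm x).1, continuous_subtype_val.comp e.symm.continuous, he, fun x => ?_⟩
    rw [← hφ _ (e.symm x).2, he]
  · rintro ⟨σ, hσ, hs, hr⟩
    have hloc : IsLocalHomeomorph σ :=
      IsLocalHomeomorph.of_comp (g := src)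
        (by rw [show src ∘ σ = id from funext hs]; exact (Homeomorph.refl X).isLocalHomeomorph)
        isLocalHomeomorph_src hσ
    have hopen : IsOpen (Set.range σ) := hloc.isOpenMap.isOpen_range
    refine ⟨Set.range σ, ⟨isCompact_range hσ, hopen, Set.range σ, hopen, subset_rfl, ?_, ?_⟩,
      ?_, ?_, ?_⟩
    · refine IsOpenEmbedding.of_continuous_injective_isOpenMap
        (isLocalHomeomorph_src.continuous.comp continuous_subtype_val) ?_
        (isLocalHomeomorph_src.isOpenMap.comp hopen.isOpenMap_subtype_val)
      rintro ⟨_, x, rfl⟩ ⟨_, y, rfl⟩ h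
      have : x = y := by simpa [hs] using h
      subst this
      rfl
    · have hR := IsEtaleGroupoid.isLocalHomeomorph_rng (X := X)
      refine IsOpenEmbedding.of_continuous_injective_isOpenMap
        (hR.continuous.comp continuous_subtype_val) ?_
        (hR.isOpenMap.comp hopen.isOpenMap_subtype_val)
      rintro ⟨_, x, rfl⟩ ⟨_, y, rfl⟩ h
      have : x = y := by simpa [hr] using h
      subst this
      rfl
    · exact Set.eq_univ_of_forall fun x => ⟨σ x, ⟨x, rfl⟩, hs x⟩
    · exact Set.eq_univ_of_forall fun x => ⟨σ (φ.symm x), ⟨_, rfl⟩, by simp [hr]⟩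
    · rintro _ ⟨x, rfl⟩
      rw [hs, hr]

/-- The topological full group of an étale groupoid with compact unit space, as a group of
homeomorphisms of the unit space. -/
def topologicalFullGroup (X : Type u) [Groupoid.{v} X] [TopologicalSpace X]
    [TopologicalSpace (Arr X)] [IsEtaleGroupoid X] [CompactSpace X] : Subgroup (X ≃ₜ X) where
  carrier := {φ | IsFullGroupElement φ}
  one_mem' := (isFullGroupElement_iff 1).2
    ⟨unit, IsTopologicalGroupoid.continuous_unit, fun _ => rfl, fun _ => rfl⟩
  mul_mem' := by
    intro φ ψ hφ hψ
    obtain ⟨σ, hσ, hs, hr⟩ := (isFullGroupElement_iff φ).1 hφ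
    obtain ⟨τ, hτ, hs', hr'⟩ := (isFullGroupElement_iff ψ).1 hψ
    have h : ∀ x, src (σ (ψ x)) = rng (τ x) := fun x => by rw [hs, hr']
    refine (isFullGroupElement_iff (φ * ψ)).2 ⟨fun x => mul (σ (ψ x)) (τ x) (h x), ?_,
      fun x => hs' x, fun x => hr (ψ x)⟩
    exact IsTopologicalGroupoid.continuous_mul.comp
      (((hσ.comp ψ.continuous).prodMk hτ).subtype_mk h)
  inv_mem' := by
    intro φ hφ
    obtain ⟨σ, hσ, hs, hr⟩ := (isFullGroupElement_iff φ).1 hφ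
    refine (isFullGroupElement_iff φ⁻¹).2 ⟨fun x => inv (σ (φ.symm x)),
      IsTopologicalGroupoid.continuous_inv.comp (hσ.comp φ.symm.continuous), fun x => ?_,
      fun x => hs (φ.symm x)⟩
    exact (hr (φ.symm x)).trans (φ.apply_symm_apply x)

end FullGroup

/-! ### Sofic groups -/

/-- The normalized Hamming distance on the maps from a finite set with `n` elements to itself. -/
noncomputable def hammingDistance {n : ℕ} (f g : Fin n → Fin n) : ℝ :=
  (hammingDist f g : ℝ) / (n : ℝ)

/-- A group `Γ` is sofic if for every finite `F ⊆ Γ` and `ε > 0` there are a finite non-empty set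
`A` and a map `Θ : Γ → Map(A)` with `Θ(1) = id` that is multiplicative on `F` up to `ε` and moves
almost all points of `A` for all non-trivial elements of `F`. The set `A` is `Fin n`. -/
def IsSofic (Γ : Type*) [Group Γ] : Prop :=
  ∀ (F : Finset Γ) (ε : ℝ), 0 < ε →
    ∃ (n : ℕ) (Θ : Γ → Fin n → Fin n), 0 < n ∧
      (∀ f ∈ F, ∀ g ∈ F, f * g ∈ F → hammingDistance (Θ (f * g)) (Θ f ∘ Θ g) ≤ ε) ∧
      (∀ f ∈ F, f ≠ 1 → 1 - ε < hammingDistance (Θ f) id) ∧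
      Θ 1 = id

end EtaleGroupoid

namespace EtaleGroupoid

/-! ### Amplification of sofic approximations -/

/-! The full group acts on the unit space, and the finite sets on which it is modelled are `A =
r(Sₙu)` for one fixed unit `u`. Normality of `Sₙ` makes `r` injective on `Sₙu`
(`IsNormalFolner.injOn_rng_fiber`), so smallness of `KSₙu \ Sₙu` says that bisections move few
points of `A` out of `A` (`ncard_escape_le`). Cutting the action down to `A` gives almost
multiplicative self-maps, which need not be bijective.

A non-trivial `f` might still fix most of `A`. Minimality and compactness give finitely many
bisections, depending only on `f`, that carry every unit into the open set moved by `f`. Since `A`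
is almost invariant under them, that set contains a definite proportion of `A`
(`card_le_sum_escape`).

This proportion need not be close to 1. Acting diagonally on `A^k` raises the proportion of fixed
points to the `k`-th power, while the multiplicativity defect grows at most by the factor `k`
(`isSofic_of_exists_pos`). -/

/-- The coordinatewise agreement set of two self-maps of a finite power of `A`. -/
theorem card_pow_agree {A : Type*} [Fintype A] [DecidableEq A] (k : ℕ) (α β : A → A) :
    (Finset.univ.filter fun p : Fin k → A => (fun i => α (p i)) = fun i => β (p i)).card =
      (Finset.univ.filter fun x => α x = β x).card ^ k := by
  have : (Finset.univ.filter fun p : Fin k → A => (fun i => α (p i)) = fun i => β (p i)) =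
      Fintype.piFinset fun _ => Finset.univ.filter fun x => α x = β x := by
    ext p
    simp [funext_iff]
  rw [this, Fintype.card_piFinset]
  simp

/-- The normalized Hamming distance of two maps transported to `Fin n`. -/
theorem hammingDistance_conj {P : Type*} [Fintype P] [DecidableEq P] [Nonempty P] {n : ℕ}
    (e : P ≃ Fin n) (α β : P → P) :
    hammingDistance (fun j => e (α (e.symm j))) (fun j => e (β (e.symm j))) =
      1 - ((Finset.univ.filter fun p => α p = β p).card : ℝ) / (Fintype.card P : ℝ) := by
  have hn : n = Fintype.card P := by simpa using (Fintype.card_congr e).symm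
  have hpos : (0 : ℝ) < Fintype.card P := by exact_mod_cast Fintype.card_pos
  have h1 : hammingDist (fun j => e (α (e.symm j))) (fun j => e (β (e.symm j))) =
      (Finset.univ.filter fun p => ¬ α p = β p).card := by
    unfold hammingDist
    refine Finset.card_bij (fun j _ => e.symm j) ?_ ?_ ?_
    · intro j hj
      simpa using hj
    · intro a _ b _ h
      exact e.symm.injective h
    · intro p hp
      exact ⟨e p, by simpa using hp, by simp⟩
  have h2 := Finset.card_filter_add_card_filter_not (s := (Finset.univ : Finset P))
    (fun p => α p = β p)
  rw [Finset.card_univ] at h2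
  have h3 : ((Finset.univ.filter fun p => α p = β p).card : ℝ) +
      (Finset.univ.filter fun p => ¬ α p = β p).card = Fintype.card P := by exact_mod_cast h2
  unfold hammingDistance
  rw [h1, hn, eq_sub_iff_add_eq, ← add_div, add_comm, h3, div_self hpos.ne']

/-- A group is sofic if it has almost multiplicative maps to self-maps of finite sets for which the
non-trivial elements of a given finite set move a proportion of the points bounded below. -/
theorem isSofic_of_exists_pos {Γ : Type*} [Group Γ]
    (h : ∀ F : Finset Γ, ∃ c : ℝ, 0 < c ∧ ∀ δ : ℝ, 0 < δ →
      ∃ (A : Type u) (_ : Fintype A) (_ : DecidableEq A) (_ : Nonempty A) (θ : Γ → A → A),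
        θ 1 = id ∧
        (∀ f ∈ F, ∀ g ∈ F, f * g ∈ F →
          (1 - δ) * Fintype.card A ≤
            ((Finset.univ.filter fun x => θ (f * g) x = θ f (θ g x)).card : ℝ)) ∧
        ∀ f ∈ F, f ≠ 1 →
          ((Finset.univ.filter fun x => θ f x = x).card : ℝ) ≤ (1 - c) * Fintype.card A) :
    IsSofic Γ := by
  intro F ε hε
  obtain ⟨c, hc, H⟩ := h F
  wlog hc1 : c ≤ 1 generalizing c
  · refine this 1 one_pos (fun δ hδ => ?_) le_rfl
    obtain ⟨A, i1, i2, i3, θ, h1, h2, h3⟩ := H δ hδ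
    refine ⟨A, i1, i2, i3, θ, h1, h2, fun f hf hf1 => (h3 f hf hf1).trans ?_⟩
    have : (0 : ℝ) ≤ Fintype.card A := by positivity
    nlinarith
  obtain ⟨k, hk⟩ := exists_pow_lt_of_lt_one hε (show 1 - c < 1 by linarith)
  have hk1 : (0 : ℝ) < k + 1 := by positivity
  -- The defect on the `k`-th power is at most `k * δ`; `k + 1` covers `k = 0`, and the cap keeps `1
  -- - δ` non-negative.
  set δ : ℝ := min (ε / (k + 1)) 1 with hδdef
  have hδ : 0 < δ := lt_min (by positivity) one_pos
  have hδ1 : δ ≤ 1 := min_le_right _ _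
  have hδk : k * δ ≤ ε := by
    have : δ * (k + 1) ≤ ε := (le_div_iff₀ hk1).1 (min_le_left _ _)
    nlinarith
  obtain ⟨A, _, _, _, θ, h1, h2, h3⟩ := H δ hδ
  have hA : (0 : ℝ) < Fintype.card A := by exact_mod_cast Fintype.card_pos
  let e := Fintype.equivFin (Fin k → A)
  have key : ∀ α β : A → A,
      hammingDistance (fun j => e (fun i => α (e.symm j i))) (fun j => e (fun i => β (e.symm j i)))
        = 1 - (((Finset.univ.filter fun x => α x = β x).card : ℝ) / Fintype.card A) ^ k := by
    intro α β
    rw [hammingDistance_conj e (fun p i => α (p i)) (fun p i => β (p i)), card_pow_agree, div_pow]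
    simp
  refine ⟨Fintype.card (Fin k → A), fun f j => e (fun i => θ f (e.symm j i)), Fintype.card_pos,
    ?_, ?_, ?_⟩
  · intro f hf g hg hfg
    have h4 := h2 f hf g hg hfg
    have hcomp : ((fun j => e (fun i => θ f (e.symm j i))) ∘ fun j => e (fun i => θ g (e.symm j i)))
        = fun j => e (fun i => (fun x => θ f (θ g x)) (e.symm j i)) := by
      funext j
      simp
    change hammingDistance _ ((fun j => e (fun i => θ f (e.symm j i))) ∘
      fun j => e (fun i => θ g (e.symm j i))) ≤ ε
    rw [hcomp]
    refine (key (θ (f * g)) fun x => θ f (θ g x)).trans_le ?_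
    have h5 : (1 - δ) ^ k ≤
        (((Finset.univ.filter fun x => θ (f * g) x = θ f (θ g x)).card : ℝ) /
          Fintype.card A) ^ k :=
      pow_le_pow_left₀ (by linarith) ((le_div_iff₀ hA).2 h4) k
    -- Bernoulli: `(1 - δ) ^ k ≥ 1 - k * δ ≥ 1 - ε`.
    have h6 := one_add_mul_le_pow (show (-2 : ℝ) ≤ -δ by linarith) k
    rw [← sub_eq_add_neg] at h6
    linarith
  · intro f hf hf1
    have hid : (id : Fin (Fintype.card (Fin k → A)) → _) =
        fun j => e (fun i => (id : A → A) (e.symm j i)) := by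
      funext j
      simp
    rw [hid]
    refine lt_of_lt_of_eq ?_ (key (θ f) id).symm
    have h5 : (((Finset.univ.filter fun x => θ f x = id x).card : ℝ) / Fintype.card A) ^ k ≤
        (1 - c) ^ k :=
      pow_le_pow_left₀ (by positivity) ((div_le_iff₀ hA).2 (h3 f hf hf1)) k
    linarith
  · funext j
    simp [h1]

/-! ### Compressing an action to an almost invariant finite set -/

/-- The partial action of a permutation on a subset, extended by the identity. -/
noncomputable def compress {X : Type u} (A : Finset X) (φ : X → X) (x : A) : A :=
  open Classical in if h : φ x ∈ A then ⟨φ x, h⟩ else x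

theorem compress_of_mem {X : Type u} {A : Finset X} {φ : X → X} {x : A} (h : φ x ∈ A) :
    compress A φ x = ⟨φ x, h⟩ := dif_pos h

/-- A group of permutations of a set is sofic if there are almost invariant finite subsets of which
the non-trivial elements of a given finite set move a proportion bounded below. -/
theorem isSofic_of_almost_invariant {X : Type u} {Γ : Type*} [Group Γ] [DecidableEq X]
    (a : Γ → X → X) (a_one : ∀ x, a 1 x = x) (a_mul : ∀ f g x, a (f * g) x = a f (a g x))
    (h : ∀ F : Finset Γ, ∃ c : ℝ, 0 < c ∧ ∀ δ : ℝ, 0 < δ →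
      ∃ A : Finset X, A.Nonempty ∧
        (∀ f ∈ F, ((A.filter fun x => a f x ∉ A).card : ℝ) ≤ δ * A.card) ∧
        ∀ f ∈ F, f ≠ 1 → c * A.card ≤ ((A.filter fun x => a f x ≠ x).card : ℝ)) :
    IsSofic Γ := by
  apply isSofic_of_exists_pos.{u}
  intro F
  obtain ⟨c, hc, H⟩ := h F
  refine ⟨c / 2, by positivity, fun δ hδ => ?_⟩
  -- Multiplicativity can fail on two escape sets, those of `g` and of `f * g`, hence `δ / 2`.
  -- Escaping points become fixed, so `c / 2` leaves a proportion `c / 2` moved.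
  obtain ⟨A, hA, h1, h2⟩ := H (min (δ / 2) (c / 2)) (by positivity)
  have hbad : ∀ f ∈ F, ((A.filter fun x => a f x ∉ A).card : ℝ) ≤ δ / 2 * A.card ∧
      ((A.filter fun x => a f x ∉ A).card : ℝ) ≤ c / 2 * A.card := fun f hf =>
    ⟨(h1 f hf).trans (by gcongr; exact min_le_left _ _),
      (h1 f hf).trans (by gcongr; exact min_le_right _ _)⟩
  have hcount : ∀ p : X → Prop, ∀ [DecidablePred p],
      (Finset.univ.filter fun x : A => p x).card = (A.filter p).card := by
    intro p _
    rw [← Finset.card_map (Function.Embedding.subtype (· ∈ A))]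
    congr 1
    ext x
    simp [and_comm]
  refine ⟨A, inferInstance, inferInstance, hA.to_subtype, fun f => compress A (a f), ?_, ?_, ?_⟩
  · funext x
    have hx : a 1 x ∈ A := by rw [a_one]; exact x.2
    exact (compress_of_mem hx).trans (Subtype.ext (a_one x))
  · intro f _ g hg hfg
    have hsub : (Finset.univ : Finset A) ⊆
        (Finset.univ.filter fun x => compress A (a (f * g)) x =
          compress A (a f) (compress A (a g) x)) ∪
        ((Finset.univ.filter fun x : A => a g x ∉ A) ∪
          (Finset.univ.filter fun x : A => a (f * g) x ∉ A)) := by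
      intro x _
      simp only [Finset.mem_union, Finset.mem_filter, Finset.mem_univ, true_and]
      by_cases hx : a g x ∈ A
      · by_cases hy : a (f * g) x ∈ A
        · left
          rw [compress_of_mem hy, compress_of_mem hx,
            compress_of_mem (by simpa [a_mul] using hy)]
          exact Subtype.ext (a_mul f g x)
        · exact Or.inr (Or.inr hy)
      · exact Or.inr (Or.inl hx)
    have h3 := (Finset.card_le_card hsub).trans
      ((Finset.card_union_le _ _).trans (Nat.add_le_add_left (Finset.card_union_le _ _) _))
    rw [Finset.card_univ, hcount (fun x => a g x ∉ A), hcount (fun x => a (f * g) x ∉ A)] at h3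
    have h4 : (Fintype.card A : ℝ) ≤ (Finset.univ.filter fun x => compress A (a (f * g)) x =
          compress A (a f) (compress A (a g) x)).card + ((A.filter fun x => a g x ∉ A).card +
          (A.filter fun x => a (f * g) x ∉ A).card) := by exact_mod_cast h3
    have h5 := (hbad g hg).1
    have h6 := (hbad _ hfg).1
    rw [Fintype.card_coe] at h4 ⊢
    linarith
  · intro f hf hf1
    have hsub : (Finset.univ.filter fun x => compress A (a f) x = x) ⊆
        (Finset.univ.filter fun x : A => a f x ∉ A) ∪
          (Finset.univ.filter fun x : A => ¬ a f x ≠ x) := by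
      intro x hx
      simp only [Finset.mem_union, Finset.mem_filter, Finset.mem_univ, true_and] at hx ⊢
      by_cases hy : a f x ∈ A
      · rw [compress_of_mem hy] at hx
        exact Or.inr (not_not.2 (congrArg Subtype.val hx))
      · exact Or.inl hy
    have h3 := (Finset.card_le_card hsub).trans (Finset.card_union_le _ _)
    rw [hcount (fun x => a f x ∉ A), hcount (fun x => ¬ a f x ≠ x)] at h3
    have h4 : ((Finset.univ.filter fun x => compress A (a f) x = x).card : ℝ) ≤
        (A.filter fun x => a f x ∉ A).card + (A.filter fun x => ¬ a f x ≠ x).card := by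
      exact_mod_cast h3
    have h5 : ((A.filter fun x => a f x ≠ x).card : ℝ) + (A.filter fun x => ¬ a f x ≠ x).card =
        A.card := by
      exact_mod_cast Finset.card_filter_add_card_filter_not (s := A) (fun x => a f x ≠ x)
    have h6 := (hbad f hf).2
    have h7 := h2 f hf hf1
    rw [Fintype.card_coe]
    linarith

/-! ### Bisections, multisections and Følner sets -/

section Groupoid

variable {X : Type u} [CategoryTheory.Groupoid.{v} X]

/-- The points of `A` that some element of `B` maps out of `A`. -/
def escape (B : Set (Arr X)) (A : Set X) : Set X :=
  {x ∈ A | ∃ b ∈ B, src b = x ∧ rng b ∉ A}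

/-- For a set `B` on which source and range are injective, the number of points of `r(T)` that `B`
moves out of `r(T)` is at most the size of the outer boundary of `T`. -/
theorem ncard_escape_le {B T : Set (Arr X)} (hs : Set.InjOn src B) (hr : Set.InjOn rng B)
    (hT : T.Finite) :
    (escape B (rng '' T)).ncard ≤ (setMul B T \ T).ncard := by
  rcases isEmpty_or_nonempty X with hX | hX
  · simp [Set.eq_empty_of_isEmpty]
  have : Nonempty (Arr X) := hX.map unit
  -- `ncard` of an infinite set is 0, so finiteness is essential. Each `t ∈ T` is composable with at
  -- most one `b ∈ B`.
  have hfin : (setMul B T).Finite := by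
    have hsub : setMul B T ⊆ ⋃ t ∈ T, {g | ∃ b ∈ B, ∃ h : src b = rng t, mul b t h = g} := by
      rintro g ⟨b, hb, t, ht, h, rfl⟩
      exact Set.mem_biUnion ht ⟨b, hb, h, rfl⟩
    refine (hT.biUnion fun t _ => Set.Subsingleton.finite ?_).subset hsub
    rintro _ ⟨b, hb, h, rfl⟩ _ ⟨b', hb', h', rfl⟩
    obtain rfl := hs hb hb' (h.trans h'.symm)
    rfl
  -- Send `x = r(t)`, escaping through `b`, to `bt`. Its range `r(b)` is outside `r(T)`, so `bt ∉
  -- T`, and it determines `b`, hence `x`.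
  have H : ∀ x ∈ escape B (rng '' T), ∃ g ∈ setMul B T \ T, ∃ b ∈ B, src b = x ∧ rng g = rng b := by
    rintro x ⟨⟨t, ht, rfl⟩, b, hb, hx, hn⟩
    exact ⟨mul b t hx, ⟨⟨b, hb, t, ht, hx, rfl⟩, fun hm => hn ⟨_, hm, rfl⟩⟩, b, hb, hx, rfl⟩
  choose! g hg b hb hbx hgb using H
  refine Set.ncard_le_ncard_of_injOn g hg ?_ hfin.sdiff
  intro x hx y hy hxy
  have : b x = b y := hr (hb x hx) (hb y hy) (by rw [← hgb x hx, ← hgb y hy, hxy])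
  rw [← hbx x hx, ← hbx y hy, this]

variable [TopologicalSpace X] [TopologicalSpace (Arr X)]

theorem IsCompactOpenBisection.injOn_src {B : Set (Arr X)} (h : IsCompactOpenBisection B) :
    Set.InjOn src B := by
  obtain ⟨-, -, U, -, hBU, hs, -⟩ := h
  intro a ha b hb hab
  exact congrArg Subtype.val (hs.injective (a₁ := ⟨a, hBU ha⟩) (a₂ := ⟨b, hBU hb⟩) hab)

theorem IsCompactOpenBisection.injOn_rng {B : Set (Arr X)} (h : IsCompactOpenBisection B) :
    Set.InjOn rng B := by
  obtain ⟨-, -, U, -, hBU, -, hr⟩ := h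
  intro a ha b hb hab
  exact congrArg Subtype.val (hr.injective (a₁ := ⟨a, hBU ha⟩) (a₂ := ⟨b, hBU hb⟩) hab)

/-- In a factorization of `g` along `C i j = C i j · C j j`, the second factor is a unit,
necessarily the one at the source. -/
theorem IsCompactOpenMultisection.unit_src_mem {ι : Type*} {C : ι → ι → Set (Arr X)}
    (h : IsCompactOpenMultisection C) {i j : ι} {g : Arr X} (hg : g ∈ C i j) :
    unit (src g) ∈ C j j := by
  rw [← h.setMul_eq i j j] at hg
  obtain ⟨a, -, b, hb, hab, rfl⟩ := hg
  obtain ⟨x, rfl⟩ := h.subset_unitSet j hb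
  exact hb

theorem IsCompactOpenMultisection.unit_rng_mem {ι : Type*} {C : ι → ι → Set (Arr X)}
    (h : IsCompactOpenMultisection C) {i j : ι} {g : Arr X} (hg : g ∈ C i j) :
    unit (rng g) ∈ C i i := by
  rw [← h.setMul_eq i i j] at hg
  obtain ⟨a, ha, b, -, hab, rfl⟩ := hg
  obtain ⟨x, rfl⟩ := h.subset_unitSet i ha
  exact ha

/-- The range map is injective on the source fibres of a normal Følner set. -/
theorem IsNormalFolner.injOn_rng_fiber {K S : Set (Arr X)} {ε : ℝ} (h : IsNormalFolner K ε S)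
    (u : X) : Set.InjOn rng (fiber S u) := by
  obtain ⟨-, -, m, k, C, i₀, hC, rfl, -, -, hdisj, -⟩ := h
  rintro g ⟨hg, hgu⟩ g' ⟨hg', hgu'⟩ hrng
  simp only [Set.mem_iUnion] at hg hg'
  obtain ⟨l, i, hg⟩ := hg
  obtain ⟨l', i', hg'⟩ := hg'
  have hu := (hC l).unit_src_mem hg
  have hu' := (hC l').unit_src_mem hg'
  rw [hgu] at hu
  rw [hgu'] at hu'
  -- The common source determines `l`, the common range then determines `i`, and the bisection `C l
  -- i (i₀ l)` has only one arrow with source `u`.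
  obtain rfl : l = l' := by
    by_contra hne
    exact Set.disjoint_left.1 (hdisj hne) hu hu'
  have hv := (hC l).unit_rng_mem hg
  have hv' := (hC l).unit_rng_mem hg'
  rw [← hrng] at hv'
  obtain rfl : i = i' := by
    by_contra hne
    exact Set.disjoint_left.1 ((hC l).disjoint hne) hv hv'
  exact ((hC l).bisection i (i₀ l)).injOn_src hg hg' (hgu.trans hgu'.symm)

/-- A groupoid with a Følner sequence has finite non-empty sets of units that are almost invariant
under finitely many given compact open bisections. -/
theorem IsFolnerSequence.exists_almost_invariant {S : ℕ → Set (Arr X)} (hS : IsFolnerSequence S)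
    (u : X) {𝓑 : Set (Set (Arr X))} (hfin : 𝓑.Finite) (h𝓑 : ∀ B ∈ 𝓑, IsCompactOpenBisection B)
    {δ : ℝ} (hδ : 0 < δ) :
    ∃ A : Finset X, A.Nonempty ∧ ∀ B ∈ 𝓑, ((escape B (A : Set X)).ncard : ℝ) ≤ δ * A.card := by
  classical
  have hev : ∀ᶠ n in Filter.atTop, ∀ B ∈ 𝓑,
      ((setMul B (fiber (S n) u) \ fiber (S n) u).ncard : ℝ) / ((fiber (S n) u).ncard : ℝ) < δ :=
    (Filter.eventually_all_finite hfin).2 fun B hB =>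
      (hS.2 B (h𝓑 B hB).1 u).eventually_lt_const hδ
  obtain ⟨n, hn⟩ := hev.exists
  obtain ⟨K, ε, -, -, hnorm⟩ := hS.1 n
  have hinj := hnorm.injOn_rng_fiber u
  obtain ⟨-, -, _, _, _, _, -, -, -, -, -, hF⟩ := hnorm
  obtain ⟨hTfin, hTne, -, -⟩ := hF u
  have hfinA := hTfin.image rng
  refine ⟨hfinA.toFinset, by simpa using hTne, fun B hB => ?_⟩
  rw [Set.Finite.coe_toFinset, ← Set.ncard_eq_toFinset_card _ hfinA, hinj.ncard_image]
  have hpos : (0 : ℝ) < (fiber (S n) u).ncard := by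
    exact_mod_cast (Set.ncard_pos hTfin).2 hTne
  refine le_trans ?_ ((div_le_iff₀ hpos).1 (hn B hB).le)
  exact_mod_cast ncard_escape_le (h𝓑 B hB).injOn_src (h𝓑 B hB).injOn_rng hTfin

/-! ### Minimality: moving units into an open set -/

/-- In a minimal groupoid every orbit meets every non-empty open set of units. -/
theorem IsMinimalGroupoid.exists_rng_mem [IsEtaleGroupoid X] (hmin : IsMinimalGroupoid X)
    {U : Set X} (hU : IsOpen U) (hne : U.Nonempty) (x : X) :
    ∃ g : Arr X, src g = x ∧ rng g ∈ U := by
  -- The units whose orbit meets `U` form an open set with invariant complement.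
  have hopen : IsOpen (src '' (rng ⁻¹' U : Set (Arr X))) :=
    isLocalHomeomorph_src.isOpenMap _
      (hU.preimage (IsTopologicalGroupoid.continuous_rng (X := X)))
  have hinv : IsInvariant (src '' (rng ⁻¹' U : Set (Arr X)))ᶜ := by
    refine Set.Subset.antisymm ?_ fun y hy => ⟨unit y, hy, rfl⟩
    rintro _ ⟨g, hg, rfl⟩ ⟨k, hk, hkg⟩
    exact hg ⟨mul k g hkg, hk, rfl⟩
  rcases hmin _ hopen.isClosed_compl hinv with h | h
  · rw [Set.compl_empty_iff] at h
    have hx : x ∈ src '' (rng ⁻¹' U : Set (Arr X)) := h ▸ Set.mem_univ x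
    obtain ⟨g, hg, hgx⟩ := hx
    exact ⟨g, hgx, hg⟩
  · obtain ⟨y, hy⟩ := hne
    have hy' : y ∈ (src '' (rng ⁻¹' U : Set (Arr X)))ᶜ := h ▸ Set.mem_univ y
    exact absurd ⟨unit y, hy, rfl⟩ hy'

/-- In a minimal ample groupoid with compact unit space, finitely many compact open bisections
suffice to move every unit into a given non-empty open set. -/
theorem IsMinimalGroupoid.exists_finset_bisection [IsAmpleGroupoid X] [CompactSpace X]
    (hmin : IsMinimalGroupoid X) {U : Set X} (hU : IsOpen U) (hne : U.Nonempty) :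
    ∃ t : Finset (Set (Arr X)), (∀ B ∈ t, IsCompactOpenBisection B) ∧
      ∀ x, ∃ B ∈ t, ∃ b ∈ B, src b = x ∧ rng b ∈ U := by
  classical
  have hrU : IsOpen (rng ⁻¹' U : Set (Arr X)) :=
    hU.preimage (IsTopologicalGroupoid.continuous_rng (X := X))
  have H : ∀ x : X, ∃ B : Set (Arr X), IsCompactOpenBisection B ∧ x ∈ src '' B ∧
      B ⊆ rng ⁻¹' U := by
    intro x
    obtain ⟨g, hgx, hg⟩ := hmin.exists_rng_mem hU hne x
    obtain ⟨B, hB, hgB, hBU⟩ :=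
      (IsAmpleGroupoid.isTopologicalBasis (X := X)).exists_subset_of_mem_open
        (show g ∈ rng ⁻¹' U from hg) hrU
    exact ⟨B, hB, ⟨g, hgB, hgx⟩, hBU⟩
  choose B hB hxB hBU using H
  obtain ⟨t, ht⟩ := isCompact_univ.elim_finite_subcover (fun x => src '' B x)
    (fun x => isLocalHomeomorph_src.isOpenMap _ (hB x).2.1)
    (fun x _ => Set.mem_iUnion.2 ⟨x, hxB x⟩)
  refine ⟨t.image B, ?_, fun x => ?_⟩
  · intro C hC
    obtain ⟨x, -, rfl⟩ := Finset.mem_image.1 hC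
    exact hB x
  · obtain ⟨y, hy, b, hb, hbx⟩ := Set.mem_iUnion₂.1 (ht (Set.mem_univ x))
    exact ⟨B y, Finset.mem_image_of_mem B hy, b, hb, hbx, hBU y hb⟩

/-- If finitely many bisections move every unit into `U`, then the size of a finite set of units is
bounded by its intersection with `U` and the points escaping it. -/
theorem card_le_sum_escape [DecidableEq X] {t : Finset (Set (Arr X))} {U : Set X}
    [DecidablePred (· ∈ U)] (ht : ∀ B ∈ t, IsCompactOpenBisection B)
    (hU : ∀ x, ∃ B ∈ t, ∃ b ∈ B, src b = x ∧ rng b ∈ U) (A : Finset X) :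
    A.card ≤ ∑ B ∈ t, ((A.filter (· ∈ U)).card + (escape B (A : Set X)).ncard) := by
  classical
  rcases isEmpty_or_nonempty X with hX | hX
  · simp [Finset.eq_empty_of_isEmpty A]
  have : Nonempty (Arr X) := hX.map unit
  let P : Set (Arr X) → Finset X := fun B =>
    A.filter fun x => ∃ b ∈ B, src b = x ∧ rng b ∈ A.filter (· ∈ U)
  have hesc : ∀ B : Set (Arr X), (escape B (A : Set X)).Finite := fun B =>
    A.finite_toSet.subset fun _ hx => hx.1
  have hP : ∀ B ∈ t, (P B).card ≤ (A.filter (· ∈ U)).card := by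
    intro B hB
    have H : ∀ x ∈ P B, ∃ b ∈ B, src b = x ∧ rng b ∈ A.filter (· ∈ U) := fun x hx =>
      (Finset.mem_filter.1 hx).2
    choose! b hb hbx hbA using H
    refine Finset.card_le_card_of_injOn (fun x => rng (b x)) hbA ?_
    intro x hx y hy hxy
    rw [← hbx x hx, ← hbx y hy, (ht B hB).injOn_rng (hb x hx) (hb y hy) hxy]
  -- Each point of `A` is carried by some `B ∈ t` either into `A ∩ U`, injectively for fixed `B`, or
  -- out of `A`.
  have hsub : A ⊆ t.biUnion fun B => P B ∪ (hesc B).toFinset := by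
    intro x hx
    obtain ⟨B, hB, b, hb, hbx, hbU⟩ := hU x
    refine Finset.mem_biUnion.2 ⟨B, hB, Finset.mem_union.2 ?_⟩
    by_cases hbA : rng b ∈ A
    · exact Or.inl (Finset.mem_filter.2 ⟨hx, b, hb, hbx, Finset.mem_filter.2 ⟨hbA, hbU⟩⟩)
    · exact Or.inr ((hesc B).mem_toFinset.2 ⟨hx, b, hb, hbx, hbA⟩)
  refine (Finset.card_le_card hsub).trans (Finset.card_biUnion_le.trans ?_)
  refine Finset.sum_le_sum fun B hB => (Finset.card_union_le _ _).trans ?_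
  rw [Set.ncard_eq_toFinset_card _ (hesc B)]
  exact Nat.add_le_add_right (hP B hB) _

end Groupoid

/-- Covers the empty unit space, where there is no fibre to use. -/
theorem isSofic_of_subsingleton (Γ : Type*) [Group Γ] [Subsingleton Γ] : IsSofic Γ := by
  intro F ε hε
  refine ⟨1, fun _ => id, one_pos, fun f _ g _ _ => ?_, fun f _ hf => ?_, rfl⟩
  · simp [hammingDistance, hε.le]
  · exact absurd (Subsingleton.elim f 1) hf

end EtaleGroupoid

open EtaleGroupoid in
theorem theoremC (X : Type u) [CategoryTheory.Groupoid.{v} X] [TopologicalSpace X]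
    [TopologicalSpace (EtaleGroupoid.Arr X)] [EtaleGroupoid.IsAmpleGroupoid X]
    [LocallyCompactSpace (EtaleGroupoid.Arr X)] [T2Space (EtaleGroupoid.Arr X)]
    [SecondCountableTopology (EtaleGroupoid.Arr X)] [CompactSpace X]
    (hmin : EtaleGroupoid.IsMinimalGroupoid X)
    (hfol : ∃ S : ℕ → Set (EtaleGroupoid.Arr X), EtaleGroupoid.IsFolnerSequence S) :
    EtaleGroupoid.IsSofic (EtaleGroupoid.topologicalFullGroup X) := by
  classical
  obtain ⟨S, hS⟩ := hfol
  rcases isEmpty_or_nonempty X with hX | ⟨⟨u⟩⟩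
  · have : Subsingleton (X ≃ₜ X) := ⟨fun f g => Homeomorph.ext fun x => isEmptyElim x⟩
    exact isSofic_of_subsingleton _
  -- Makes the set of points moved by `f` open.
  have : T2Space X := T2Space.of_injective_continuous (f := unit)
    (fun x y h => congrArg src h) IsTopologicalGroupoid.continuous_unit
  refine isSofic_of_almost_invariant (fun f x => f.1 x) (fun _ => rfl) (fun _ _ _ => rfl) ?_
  intro F
  have hB : ∀ f : topologicalFullGroup X, ∃ B : Set (Arr X), IsCompactOpenBisection B ∧
      ∀ x, ∃ b ∈ B, src b = x ∧ rng b = f.1 x := by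
    rintro ⟨f, B, hB, hs, -, hf⟩
    refine ⟨B, hB, fun x => ?_⟩
    obtain ⟨b, hb, rfl⟩ : x ∈ src '' B := hs ▸ Set.mem_univ x
    exact ⟨b, hb, rfl, (hf b hb).symm⟩
  have ht : ∀ f : topologicalFullGroup X, f ≠ 1 → ∃ t : Finset (Set (Arr X)),
      (∀ B ∈ t, IsCompactOpenBisection B) ∧
        ∀ x, ∃ B ∈ t, ∃ b ∈ B, src b = x ∧ rng b ∈ {y : X | f.1 y ≠ y} := by
    intro f hf
    refine hmin.exists_finset_bisection (isOpen_ne_fun f.1.continuous continuous_id) ?_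
    by_contra hne
    refine hf (Subtype.ext (Homeomorph.ext fun x => ?_))
    by_contra hx
    exact hne ⟨x, hx⟩
  choose B hBc hB using hB
  choose! t htc ht using ht
  obtain ⟨N, hN⟩ : ∃ N : ℕ, ∀ f ∈ F, (t f).card ≤ N :=
    ⟨∑ f ∈ F, (t f).card, fun f hf =>
      Finset.single_le_sum (f := fun f => (t f).card) (fun _ _ => Nat.zero_le _) hf⟩
  have hN0 : (0 : ℝ) < 1 / (2 * (N + 1)) := by positivity
  -- With escape proportion at most `c = 1 / (2 * (N + 1))`, one gets `|A| ≤ (N + 1)(|moved| + c|A|)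
  -- = (N + 1)|moved| + |A| / 2`, so `|moved| ≥ c|A|`. The bound `N` depends on `F` but not on `δ`
  -- or `A`.
  refine ⟨1 / (2 * (N + 1)), hN0, fun δ hδ => ?_⟩
  let 𝓑 : Finset (Set (Arr X)) := F.image B ∪ (F.filter (· ≠ 1)).biUnion t
  have h𝓑 : ∀ C ∈ (𝓑 : Set (Set (Arr X))), IsCompactOpenBisection C := by
    intro C hC
    rcases Finset.mem_union.1 hC with h | h
    · obtain ⟨f, -, rfl⟩ := Finset.mem_image.1 h
      exact hBc f
    · obtain ⟨f, hf, hC⟩ := Finset.mem_biUnion.1 h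
      exact htc f (Finset.mem_filter.1 hf).2 C hC
  obtain ⟨A, hA, hesc⟩ := hS.exists_almost_invariant u 𝓑.finite_toSet h𝓑
    (lt_min hδ hN0)
  refine ⟨A, hA, fun f hf => ?_, fun f hf hf1 => ?_⟩
  · have h1 := hesc (B f) (Finset.mem_union_left _ (Finset.mem_image_of_mem B hf))
    refine le_trans ?_ (h1.trans (by gcongr; exact min_le_left _ _))
    rw [← Set.ncard_coe_finset]
    refine Nat.cast_le.2 (Set.ncard_le_ncard ?_ (A.finite_toSet.subset fun _ hx => hx.1))
    intro x hx
    obtain ⟨hxA, hx⟩ := Finset.mem_filter.1 hx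
    obtain ⟨b, hb, hbx, hbr⟩ := hB f x
    exact ⟨hxA, b, hb, hbx, by rw [hbr]; exact hx⟩
  · have h1 : (A.card : ℝ) ≤ ∑ C ∈ t f, (((A.filter fun x => f.1 x ≠ x).card : ℝ) +
        (escape C (A : Set X)).ncard) := by
      exact_mod_cast card_le_sum_escape (htc f hf1) (ht f hf1) A
    have h2 : ∀ C ∈ t f, ((A.filter fun x => f.1 x ≠ x).card : ℝ) + (escape C (A : Set X)).ncard ≤
        (A.filter fun x => f.1 x ≠ x).card + 1 / (2 * (N + 1)) * A.card := by
      intro C hC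
      have h3 := hesc C (Finset.mem_union_right _
        (Finset.mem_biUnion.2 ⟨f, Finset.mem_filter.2 ⟨hf, hf1⟩, hC⟩))
      gcongr
      refine h3.trans ?_
      gcongr
      exact min_le_right _ _
    have h3 := h1.trans (Finset.sum_le_card_nsmul _ _ _ h2)
    rw [nsmul_eq_mul] at h3
    have h4 : ((t f).card : ℝ) ≤ N + 1 := by
      exact_mod_cast (hN f hf).trans (Nat.le_succ N)
    have h5 := h3.trans (mul_le_mul_of_nonneg_right h4 (by positivity))
    have h6 : ((N : ℝ) + 1) * (1 / (2 * (N + 1)) * A.card) = A.card / 2 := by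
      field_simp
    rw [mul_add, h6] at h5
    rw [div_mul_eq_mul_div, one_mul, div_le_iff₀ (by positivity)]
    linarith
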